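/- Let $0<R\le\infty$, let $U$ be absolutely monotonic on $(0,R)$ (that is, $U\in C^\infty(0,R)$ and $U^{(k)}\ge 0$ on $(0,R)$ for all $k\ge 0$), and let $V(x)=x(1+xU(x))$ for $x\in(0,R)$. Put $$s(x)=\exp\left(\int\frac{dx}{V(x)}\right),\qquad b(x)=\exp\left(\int\frac{x\,dx}{V(x)}\right),\qquad 0<x<R,$$ where the integrals denote arbitrary antiderivatives on $(0,R)$. Then $s$ is a strictly increasing bijection of $(0,R)$ onto an interval $(0,S)$, $0<S\le\infty$, and $V$ is the covariance on $(0,R)$ of the power series distribution of the function $\omega(y)=b(s^{-1}(y))$. This means the following. There are coefficients $a_k\ge 0$ such that the power series $\sum_{k\ge 0}a_ky^k$ has a radius of convergence $\rho\ge S$ and the sum $b(s^{-1}(y))>0$ for $0<y<S$. For every $y\in(0,\rho)$ the numbers $$p_k=\frac{a_ky^k}{\sum_{j\ge 0}a_jy^j},\qquad k=0,1,2,\dots,$$ are the probabilities $P\{\xi=k\}$ of a random variable $\xi=\xi_y$ with a finite second moment. Its mean is an injective function of $y\in(0,\rho)$ that takes every value $x\in(0,R)$, and for every $x\in(0,R)$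 the variance of the $\xi_y$ whose mean is $x$ equals $V(x)$. -/

import Mathlib

open Set MeasureTheory ProbabilityTheory
open scoped ENNReal

/-- The open interval `(0, R)` of the real line, where `0 ≤ R ≤ ∞`. -/
def posInterval (R : ℝ≥0∞) : Set ℝ := {x | 0 < x ∧ ENNReal.ofReal x < R}

/-- The radius of convergence of the power series `∑ a k * y ^ k`. -/
noncomputable def psRadius (a : ℕ → ℝ) : ℝ≥0∞ :=
  (FormalMultilinearSeries.ofScalars ℝ a).radius

/-- The sum of the power series `∑ a k * y ^ k`. -/
noncomputable def psSum (a : ℕ → ℝ) (y : ℝ) : ℝ := ∑' k, a k * y ^ k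

/-- The power series distribution with coefficients `a` and parameter `y`: the law on `ℕ` that
gives the mass `a k * y ^ k / ∑ a j * y ^ j` to the integer `k`. -/
noncomputable def psd (a : ℕ → ℝ) (y : ℝ) : Measure ℕ :=
  Measure.sum fun k => ENNReal.ofReal (a k * y ^ k / psSum a y) • Measure.dirac k

/-- The expected value of the power series distribution with parameter `y`. -/
noncomputable def psdMean (a : ℕ → ℝ) (y : ℝ) : ℝ := ∫ k, (k : ℝ) ∂(psd a y)

/-- The variance of the power series distribution with parameter `y`. -/
noncomputable def psdVariance (a : ℕ → ℝ) (y : ℝ) : ℝ :=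
  variance (fun k : ℕ => (k : ℝ)) (psd a y)

/-- The parameter `y ∈ (0, ρ)`, with `ρ` the radius of convergence, for which the power series
distribution has the mean `x`: the inverse function `y = f x` of the mean `x = x y`. -/
noncomputable def psdParam (a : ℕ → ℝ) (x : ℝ) : ℝ :=
  Function.invFunOn (psdMean a) (posInterval (psRadius a)) x

/-- The covariance characteristic: the variance of the power series distribution
as a function of its mean `x`. -/
noncomputable def psdCovariance (a : ℕ → ℝ) (x : ℝ) : ℝ := psdVariance a (psdParam a x)

/-- On `(0, S)` the function `ω` is the sum of the power series with coefficients `a`; these are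
non-negative, the sum is positive, and the radius of convergence is at least `S`. So the power
series distribution of `ω` is `psd a`. -/
structure IsPSDFunction (a : ℕ → ℝ) (ω : ℝ → ℝ) (S : ℝ≥0∞) : Prop where
  nonneg : ∀ k, 0 ≤ a k
  le_radius : S ≤ psRadius a
  hasSum : ∀ y ∈ posInterval S, HasSum (fun k => a k * y ^ k) (ω y)
  pos : ∀ y ∈ posInterval S, 0 < ω y

/-- `V` is, on the set `X`, the covariance of the power series distribution with coefficients `a`:
for all parameters in `(0, ρ)` the distribution is a probability measure with a finite second
moment, its mean is an injective function of the parameter, every `x ∈ X` is a value of the mean,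
and `V x` is the variance of the distribution whose mean is `x`. -/
structure IsPSDCovarianceOn (a : ℕ → ℝ) (V : ℝ → ℝ) (X : Set ℝ) : Prop where
  isProbabilityMeasure : ∀ y ∈ posInterval (psRadius a), IsProbabilityMeasure (psd a y)
  memLp : ∀ y ∈ posInterval (psRadius a), MemLp (fun k : ℕ => (k : ℝ)) 2 (psd a y)
  injOn : InjOn (psdMean a) (posInterval (psRadius a))
  subset_range : X ⊆ psdMean a '' posInterval (psRadius a)
  eqOn : EqOn V (psdCovariance a) X

/-! Put `g = s⁻¹` and `ω = b ∘ g`. The definitions of `s` and `b` become `y g' = V(g)` and `y ω' = g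
ω`. If `ω` is a power series with non-negative coefficients, the mean of its distribution is `y ω' /
ω = g`, and the variance is `y` times the derivative of the mean, that is `y g' = V(g)`; so the
variance at mean `x` is `V x`.

What remains is the sign of the coefficients. With `u = g / y` one has `g' = u + g u U(g)`, `u' = u²
U(g)`, `ω' = u ω`: the special form of `V` cancels the only negative term of `u'`. So the semiring
generated by `u`, `g`, `ω` and all `U⁽ᵏ⁾ ∘ g` consists of non-negative functions and is closed under
differentiation (`exists_nonnegDerivSeq_of_ode`). Bernstein's theorem
(`NonnegDerivSeq.exists_hasSum_pow`) then expands `ω` in powers of `y` on `(0, S)`. -/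

lemma isOpen_posInterval (R : ℝ≥0∞) : IsOpen (posInterval R) :=
  isOpen_Ioi.inter (isOpen_Iio.preimage ENNReal.continuous_ofReal)

lemma posInterval_mem_of_le {R : ℝ≥0∞} {x y : ℝ} (hy : y ∈ posInterval R) (hx : 0 < x)
    (hxy : x ≤ y) : x ∈ posInterval R :=
  ⟨hx, (ENNReal.ofReal_le_ofReal hxy).trans_lt hy.2⟩

lemma ordConnected_posInterval (R : ℝ≥0∞) : (posInterval R).OrdConnected :=
  ⟨fun _ hx _ hy _ hz => posInterval_mem_of_le hy (hx.1.trans_le hz.1) hz.2⟩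

lemma exists_lt_mem_posInterval {R : ℝ≥0∞} {x : ℝ} (hx : x ∈ posInterval R) :
    ∃ y ∈ posInterval R, x < y := by
  have h := (isOpen_posInterval R).mem_nhds hx
  obtain ⟨u, hu, hu'⟩ := (mem_nhdsGE_iff_exists_Ico_subset.1 (mem_nhdsWithin_of_mem_nhds h :
    posInterval R ∈ nhdsWithin x (Ici x)))
  have hu : x < u := hu
  exact ⟨(x + u) / 2, hu' ⟨by linarith, by linarith⟩, by linarith⟩

lemma posInterval_nonempty {R : ℝ≥0∞} (hR : 0 < R) : (posInterval R).Nonempty := by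
  obtain ⟨r, hr, hrR⟩ := ENNReal.lt_iff_exists_real_btwn.1 hR
  exact ⟨r, ENNReal.ofReal_pos.1 hrR.1, hrR.2⟩

/-! ### Absolute monotonicity and Bernstein's theorem -/

/-- `F` is a sequence of non-negative functions on `(0, S)`, each the derivative of the previous
one. -/
structure NonnegDerivSeq (F : ℕ → ℝ → ℝ) (S : ℝ≥0∞) : Prop where
  nonneg : ∀ k, ∀ x ∈ posInterval S, 0 ≤ F k x
  hasDerivAt : ∀ k, ∀ x ∈ posInterval S, HasDerivAt (F k) (F (k + 1) x) x

/-- Evaluating the multilinear Taylor coefficients at `(1, …, 1)` turns them into one-variable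
derivatives; the interval is open, so derivatives within it are derivatives. -/
lemma AbsolutelyMonotoneOn.exists_nonnegDerivSeq {U : ℝ → ℝ} {R : ℝ≥0∞}
    (hU : AbsolutelyMonotoneOn U (posInterval R)) :
    ∃ F, NonnegDerivSeq F R ∧ ∀ x ∈ posInterval R, F 0 x = U x := by
  obtain ⟨p, hp, hp0⟩ := hU
  refine ⟨fun k x => p x k fun _ => 1, ⟨fun k x hx => hp0 k hx, fun k x hx => ?_⟩, fun x hx => ?_⟩
  · have h := ((hp.fderivWithin k (by exact_mod_cast WithTop.coe_lt_top _) x hx).hasFDerivAt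
      ((isOpen_posInterval R).mem_nhds hx))
    have h2 := (ContinuousMultilinearMap.apply ℝ (fun _ : Fin k => ℝ) ℝ
      (fun _ => 1)).hasFDerivAt.comp x h
    refine HasDerivAt.congr_deriv (f := fun x => p x k fun _ => 1) h2.hasDerivAt ?_
    symm
    change p x (k + 1) _ = p x (k + 1) (Fin.cons 1 fun _ => 1)
    congr 1
    funext i
    refine Fin.cases ?_ (fun j => ?_) i <;> simp
  · have := hp.zero_eq x hx
    rw [← this]
    simp only [ContinuousMultilinearMap.curry0]
    congr 1
    exact Subsingleton.elim _ _

namespace NonnegDerivSeq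

variable {F : ℕ → ℝ → ℝ} {S : ℝ≥0∞}

lemma monotoneOn (hF : NonnegDerivSeq F S) (k : ℕ) : MonotoneOn (F k) (posInterval S) := by
  have := ordConnected_posInterval S
  refine monotoneOn_of_deriv_nonneg this.convex
    (fun x hx => (hF.hasDerivAt k x hx).continuousAt.continuousWithinAt) ?_ ?_
  · rw [(isOpen_posInterval S).interior_eq]
    exact fun x hx => (hF.hasDerivAt k x hx).differentiableAt.differentiableWithinAt
  · rw [(isOpen_posInterval S).interior_eq]
    intro x hx
    rw [(hF.hasDerivAt k x hx).deriv]
    exact hF.nonneg _ x hx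

/-- The derivative in the centre `t` telescopes, leaving only the last term. -/
lemma hasDerivAt_taylor (hF : NonnegDerivSeq F S) (n : ℕ) (y : ℝ) {t : ℝ}
    (ht : t ∈ posInterval S) :
    HasDerivAt (fun t => ∑ k ∈ Finset.range (n + 1), F k t * (y - t) ^ k / k.factorial)
      (F (n + 1) t * (y - t) ^ n / n.factorial) t := by
  induction n with
  | zero => simpa using hF.hasDerivAt 0 t ht
  | succ n ih =>
    simp_rw [Finset.sum_range_succ _ (n + 1)]
    have h1 := ((hF.hasDerivAt (n + 1) t ht).mul
      (((hasDerivAt_id t).const_sub y).pow (n + 1))).div_const ((n + 1).factorial : ℝ)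
    refine (ih.add h1).congr_deriv ?_
    have : (n.factorial : ℝ) ≠ 0 := by positivity
    simp only [Pi.pow_apply, id, Nat.factorial_succ, Nat.add_sub_cancel]
    push_cast
    field_simp
    ring

/-- Taylor's formula with the remainder in the form of Cauchy. -/
lemma taylor_cauchy (hF : NonnegDerivSeq F S) (n : ℕ) {c y : ℝ} (hc : 0 < c) (hcy : c < y)
    (hy : y ∈ posInterval S) :
    ∃ ξ ∈ Ioo c y, F 0 y - ∑ k ∈ Finset.range (n + 1), F k c * (y - c) ^ k / k.factorial
      = F (n + 1) ξ * (y - ξ) ^ n / n.factorial * (y - c) := by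
  have hmem : ∀ t ∈ Icc c y, t ∈ posInterval S := fun t ht =>
    posInterval_mem_of_le hy (hc.trans_le ht.1) ht.2
  obtain ⟨ξ, hξ, h⟩ := exists_hasDerivAt_eq_slope _ _ hcy
    (fun t ht => (hF.hasDerivAt_taylor n y (hmem t ht)).continuousAt.continuousWithinAt)
    (fun t ht => hF.hasDerivAt_taylor n y (hmem t (Ioo_subset_Icc_self ht)))
  refine ⟨ξ, hξ, ?_⟩
  rw [h, div_mul_cancel₀ _ (sub_pos.2 hcy).ne', Finset.sum_range_succ' (fun k => F k y * (y - y) ^ k / k.factorial) n]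
  simp

/-- The remainder and all the other Taylor terms are non-negative. -/
lemma coeff_le (hF : NonnegDerivSeq F S) (n : ℕ) {c y : ℝ} (hc : 0 < c) (hcy : c < y)
    (hy : y ∈ posInterval S) : F n c * (y - c) ^ n / n.factorial ≤ F 0 y := by
  obtain ⟨ξ, hξ, h⟩ := hF.taylor_cauchy n hc hcy hy
  have h1 : 0 ≤ F (n + 1) ξ * (y - ξ) ^ n / n.factorial * (y - c) := by
    have := hF.nonneg (n + 1) ξ (posInterval_mem_of_le hy (hc.trans hξ.1) hξ.2.le)
    have := sub_pos.2 hξ.2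
    have := sub_pos.2 hcy
    positivity
  have h2 : F n c * (y - c) ^ n / n.factorial
      ≤ ∑ k ∈ Finset.range (n + 1), F k c * (y - c) ^ k / k.factorial := by
    refine Finset.single_le_sum (f := fun k => F k c * (y - c) ^ k / k.factorial)
      (fun k _ => ?_) (by simp)
    have := hF.nonneg k c (posInterval_mem_of_le hy hc hcy.le)
    have := sub_pos.2 hcy
    positivity
  linarith

/-- A function with non-negative derivatives on `(0, S)` is the sum of its Taylor series. -/
lemma hasSum_taylor (hF : NonnegDerivSeq F S) {c y : ℝ} (hc : 0 < c) (hcy : c < y)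
    (hy : y ∈ posInterval S) : HasSum (fun k => F k c * (y - c) ^ k / k.factorial) (F 0 y) := by
  obtain ⟨d, hd, hyd⟩ := exists_lt_mem_posInterval hy
  have hdc : 0 < d - c := by linarith
  have hdy : 0 < d - y := by linarith
  have hyc : 0 < y - c := by linarith
  -- `coeff_le` from `ξ` to `d` bounds the Cauchy remainder by a multiple of `(n + 1) ((y - ξ) / (d
  -- - ξ)) ^ n`. That ratio decreases in `ξ`, so its value `q < 1` at `c` bounds it uniformly.
  set q := (y - c) / (d - c) with hq
  have hq0 : 0 < q := by positivity
  have hq1 : q < 1 := (div_lt_one hdc).2 (by linarith)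
  rw [hasSum_iff_tendsto_nat_of_nonneg (fun k => by
    have := hF.nonneg k c (posInterval_mem_of_le hy hc hcy.le)
    positivity), ← Filter.tendsto_add_atTop_iff_nat 1]
  have hlim : Filter.Tendsto (fun n : ℕ => (n + 1 : ℝ) * q ^ n * (F 0 d * (y - c) / (d - y)))
      Filter.atTop (nhds 0) := by
    have h1 := tendsto_self_mul_const_pow_of_lt_one hq0.le hq1
    have h2 := tendsto_pow_atTop_nhds_zero_of_lt_one hq0.le hq1
    simpa [add_mul] using (h1.add h2).mul_const (F 0 d * (y - c) / (d - y))
  have hF0d := hF.nonneg 0 d hd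
  have hrem : ∀ n : ℕ,
      0 ≤ F 0 y - ∑ k ∈ Finset.range (n + 1), F k c * (y - c) ^ k / k.factorial ∧
      F 0 y - ∑ k ∈ Finset.range (n + 1), F k c * (y - c) ^ k / k.factorial ≤
        (n + 1 : ℝ) * q ^ n * (F 0 d * (y - c) / (d - y)) := by
    intro n
    obtain ⟨ξ, hξ, h⟩ := hF.taylor_cauchy n hc hcy hy
    have hξ0 := hc.trans hξ.1
    have hFξ := hF.nonneg (n + 1) ξ (posInterval_mem_of_le hy hξ0 hξ.2.le)
    have hyξ := sub_pos.2 hξ.2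
    have hdξ : 0 < d - ξ := by linarith
    have hb := hF.coeff_le (n + 1) hξ0 (hξ.2.trans hyd) hd
    rw [h]
    refine ⟨by positivity, ?_⟩
    have hr : (y - ξ) / (d - ξ) ≤ q := by
      rw [hq, div_le_div_iff₀ hdξ hdc]
      nlinarith [hξ.1, hξ.2]
    have hr0 : 0 ≤ (y - ξ) / (d - ξ) := by positivity
    calc F (n + 1) ξ * (y - ξ) ^ n / n.factorial * (y - c)
        = (F (n + 1) ξ * (d - ξ) ^ (n + 1) / (n + 1).factorial) *
          ((n + 1 : ℝ) * ((y - ξ) / (d - ξ)) ^ n * ((y - c) / (d - ξ))) := by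
          have : (n.factorial : ℝ) ≠ 0 := by positivity
          rw [Nat.factorial_succ, div_pow]
          push_cast
          field_simp
          ring
      _ ≤ F 0 d * ((n + 1 : ℝ) * q ^ n * ((y - c) / (d - y))) := by
          have : d - y ≤ d - ξ := by linarith [hξ.2]
          gcongr
      _ = _ := by ring
  have := squeeze_zero (fun n => (hrem n).1) (fun n => (hrem n).2) hlim
  simpa using (tendsto_const_nhds (x := F 0 y)).sub this

/-- **Bernstein's theorem**: a function with non-negative derivatives on `(0, S)` is the sum of a
power series with non-negative coefficients. -/
theorem exists_hasSum_pow (hF : NonnegDerivSeq F S) (hS : 0 < S) :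
    ∃ a : ℕ → ℝ, (∀ k, 0 ≤ a k) ∧
      ∀ y ∈ posInterval S, HasSum (fun k => a k * y ^ k) (F 0 y) := by
  have hev : ∀ y ∈ posInterval S, ∀ᶠ c in nhdsWithin (0 : ℝ) (Ioi 0), c ∈ Ioo 0 y :=
    fun y hy => Ioo_mem_nhdsGT hy.1
  have hlim : ∀ k, ∃ l, 0 ≤ l ∧
      Filter.Tendsto (F k) (nhdsWithin (0 : ℝ) (Ioi 0)) (nhds l) := by
    intro k
    obtain ⟨z, hz⟩ := posInterval_nonempty hS
    have hsub : Ioo 0 z ⊆ posInterval S := fun t ht => posInterval_mem_of_le hz ht.1 ht.2.le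
    have h := ((hF.monotoneOn k).mono hsub).tendsto_nhdsWithin_Ioo_right
      (nonempty_Ioo.2 hz.1) ⟨0, by
        rintro _ ⟨t, ht, rfl⟩
        exact hF.nonneg k t (hsub ht)⟩
    exact ⟨_, ge_of_tendsto h ((hev z hz).mono fun t ht => hF.nonneg k t (hsub ht)), h⟩
  choose l hl0 hl using hlim
  refine ⟨fun k => l k / k.factorial, fun k => by have := hl0 k; positivity, fun y hy => ?_⟩
  obtain ⟨d, hd, hyd⟩ := exists_lt_mem_posInterval hy
  -- The expansion about `e`, taken at `y + e`, has increment exactly `y`. Since each `F k` is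
  -- monotone, its terms dominate those of the expansion of `F 0 y` about any `c < e`, which allows
  -- `c → 0`.
  set e := min (d - y) y with he
  have he0 : 0 < e := lt_min (by linarith) hy.1
  have hdm : y + e ∈ posInterval S := posInterval_mem_of_le hd (by linarith [hy.1])
    (by linarith [min_le_left (d - y) y])
  have hem : e ∈ posInterval S := posInterval_mem_of_le hy he0 (min_le_right _ _)
  have hsum := (hF.hasSum_taylor he0 (by linarith [hy.1]) hdm).summable
  simp only [add_sub_cancel_right] at hsum
  have hterm : ∀ k, Filter.Tendsto (fun c => F k c * (y - c) ^ k / k.factorial)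
      (nhdsWithin (0 : ℝ) (Ioi 0)) (nhds (l k / k.factorial * y ^ k)) := by
    intro k
    have h1 : Filter.Tendsto (fun c : ℝ => (y - c) ^ k) (nhdsWithin 0 (Ioi 0)) (nhds (y ^ k)) := by
      have : Continuous fun c : ℝ => (y - c) ^ k := by fun_prop
      simpa using (this.tendsto 0).mono_left nhdsWithin_le_nhds
    convert ((hl k).mul h1).div_const (k.factorial : ℝ) using 2
    ring
  have hbound : ∀ᶠ c in nhdsWithin (0 : ℝ) (Ioi 0), ∀ k,
      ‖F k c * (y - c) ^ k / k.factorial‖ ≤ F k e * y ^ k / k.factorial := by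
    filter_upwards [hev e hem, hev y hy] with c hc hcy k
    have h1 := hF.nonneg k c (posInterval_mem_of_le hy hc.1 hcy.2.le)
    have h2 : 0 < y - c := sub_pos.2 hcy.2
    rw [Real.norm_of_nonneg (by positivity)]
    have h3 := hF.monotoneOn k (posInterval_mem_of_le hy hc.1 hcy.2.le) hem hc.2.le
    have h4 : y - c ≤ y := by linarith [hc.1]
    gcongr
    exact h1.trans h3
  have hT := tendsto_tsum_of_dominated_convergence hsum hterm hbound
  have hconst : Filter.Tendsto (fun c => ∑' k, F k c * (y - c) ^ k / k.factorial)
      (nhdsWithin (0 : ℝ) (Ioi 0)) (nhds (F 0 y)) := by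
    refine tendsto_const_nhds.congr' ?_
    filter_upwards [hev y hy] with c hc
    exact (hF.hasSum_taylor hc.1 hc.2 hy).tsum_eq.symm
  have heq := tendsto_nhds_unique hT hconst
  have hs : Summable fun k => l k / k.factorial * y ^ k := by
    refine hsum.of_norm_bounded fun k => ?_
    exact le_of_tendsto (hterm k).norm (hbound.mono fun c hc => hc k)
  rw [← heq]
  exact hs.hasSum

end NonnegDerivSeq

/-- If the functions in `T` are non-negative on `(0, S)`, with derivatives that are polynomials with
natural coefficients in functions of `T`, then all such polynomials have derivatives of every order,
and these are non-negative. -/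
lemma exists_nonnegDerivSeq_of_mem_closure {T : Set (ℝ → ℝ)} {S : ℝ≥0∞}
    (h0 : ∀ g ∈ T, ∀ x ∈ posInterval S, 0 ≤ g x)
    (h1 : ∀ g ∈ T, ∃ h ∈ Subsemiring.closure T, ∀ x ∈ posInterval S, HasDerivAt g (h x) x)
    {g : ℝ → ℝ} (hg : g ∈ Subsemiring.closure T) :
    ∃ F, NonnegDerivSeq F S ∧ F 0 = g := by
  have h0' : ∀ g ∈ Subsemiring.closure T, ∀ x ∈ posInterval S, 0 ≤ g x := by
    intro g hg x hx
    induction hg using Subsemiring.closure_induction with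
    | mem g hg => exact h0 g hg x hx
    | zero => simp
    | one => simp
    | add f g _ _ hf hg => exact add_nonneg hf hg
    | mul f g _ _ hf hg => exact mul_nonneg hf hg
  have h1' : ∀ g ∈ Subsemiring.closure T, ∃ h ∈ Subsemiring.closure T,
      ∀ x ∈ posInterval S, HasDerivAt g (h x) x := by
    intro g hg
    induction hg using Subsemiring.closure_induction with
    | mem g hg => exact h1 g hg
    | zero => exact ⟨0, zero_mem _, fun x _ => hasDerivAt_const x 0⟩
    | one => exact ⟨0, zero_mem _, fun x _ => hasDerivAt_const x 1⟩
    | add f g _ _ hf hg =>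
      obtain ⟨f', hf', hf⟩ := hf
      obtain ⟨g', hg', hg⟩ := hg
      exact ⟨f' + g', add_mem hf' hg', fun x hx => (hf x hx).add (hg x hx)⟩
    | mul f g hfm hgm hf hg =>
      obtain ⟨f', hf', hf⟩ := hf
      obtain ⟨g', hg', hg⟩ := hg
      exact ⟨f' * g + f * g', add_mem (mul_mem hf' hgm) (mul_mem hfm hg'),
        fun x hx => (hf x hx).mul (hg x hx)⟩
  choose! D hD hD' using h1'
  have hmem : ∀ k, D^[k] g ∈ Subsemiring.closure T := by
    intro k
    induction k with
    | zero => exact hg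
    | succ k ih => rw [Function.iterate_succ_apply']; exact hD _ ih
  refine ⟨fun k => D^[k] g, ⟨fun k => h0' _ (hmem k), fun k x hx => ?_⟩, rfl⟩
  rw [Function.iterate_succ_apply']
  exact hD' _ (hmem k) x hx

/-! ### Power series with non-negative coefficients -/

lemma summable_of_mem_posInterval_psRadius {a : ℕ → ℝ} (ha : ∀ k, 0 ≤ a k) {y : ℝ}
    (hy : y ∈ posInterval (psRadius a)) : Summable fun k => a k * y ^ k := by
  have h := (FormalMultilinearSeries.ofScalars ℝ a).summable_norm_mul_pow (r := y.toNNReal) hy.2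
  simpa [FormalMultilinearSeries.ofScalars_norm, Real.coe_toNNReal y hy.1.le,
    abs_of_nonneg (ha _)] using h

lemma le_psRadius {a : ℕ → ℝ} (ha : ∀ k, 0 ≤ a k) {S : ℝ≥0∞}
    (h : ∀ y ∈ posInterval S, Summable fun k => a k * y ^ k) : S ≤ psRadius a := by
  refine ENNReal.le_of_forall_nnreal_lt fun r hr => ?_
  rcases eq_or_ne r 0 with rfl | hr0
  · simp
  · refine FormalMultilinearSeries.le_radius_of_summable _ ?_
    have := h r ⟨NNReal.coe_pos.2 (pos_iff_ne_zero.2 hr0), by simpa using hr⟩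
    simpa [FormalMultilinearSeries.ofScalars_norm, abs_of_nonneg (ha _)] using this

section PowerSeries

variable {c : ℕ → ℝ} {S : ℝ≥0∞}

/-- Bernoulli's inequality for `(d / y) ^ k` with `d > y` absorbs the factor `k`. -/
lemma summable_nat_mul (hc : ∀ k, 0 ≤ c k)
    (h : ∀ y ∈ posInterval S, Summable fun k => c k * y ^ k) :
    ∀ y ∈ posInterval S, Summable fun k : ℕ => (k * c k) * y ^ k := by
  intro y hy
  obtain ⟨d, hd, hyd⟩ := exists_lt_mem_posInterval hy
  have hy0 := hy.1
  have hh : 0 < (d - y) / y := div_pos (by linarith) hy0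
  refine Summable.of_nonneg_of_le (fun k => by have := hc k; positivity) (fun k => ?_)
    ((h d hd).mul_left ((d - y) / y)⁻¹)
  have hb := one_add_mul_le_pow (a := (d - y) / y) (by linarith) k
  have hdy : 1 + (d - y) / y = d / y := by field_simp; ring
  rw [hdy, div_pow, le_div_iff₀ (by positivity)] at hb
  have hck := hc k
  rw [inv_mul_eq_div, le_div_iff₀ hh]
  calc k * c k * y ^ k * ((d - y) / y) = c k * ((k * ((d - y) / y)) * y ^ k) := by ring
    _ ≤ c k * d ^ k := by
      have : 0 < y ^ k := by positivity
      gcongr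
      linarith

lemma hasDerivAt_psSum (hc : ∀ k, 0 ≤ c k)
    (h : ∀ y ∈ posInterval S, Summable fun k => c k * y ^ k) {y : ℝ} (hy : y ∈ posInterval S) :
    HasDerivAt (psSum c) (psSum (fun k => k * c k) y / y) y := by
  obtain ⟨d, hd, hyd⟩ := exists_lt_mem_posInterval hy
  have hd0 := hd.1
  have key := hasDerivAt_tsum_of_isPreconnected
    (g := fun (k : ℕ) z => c k * z ^ k) (g' := fun (k : ℕ) z => c k * (k * z ^ (k - 1)))
    ((summable_nat_mul hc h d hd).div_const d) (isOpen_Ioo (a := 0) (b := d))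
    isPreconnected_Ioo (fun k z _ => (hasDerivAt_pow k z).const_mul (c k))
    (fun k z hz => ?_) ⟨hy.1, hyd⟩ (h y hy) ⟨hy.1, hyd⟩
  · refine HasDerivAt.congr_deriv (f := psSum c) key ?_
    simp only [psSum]
    rw [← tsum_div_const]
    congr 1
    funext k
    have := hy.1.ne'
    rcases k with _ | k
    · simp
    · simp only [Nat.add_sub_cancel, pow_succ]
      field_simp
  · have := hc k
    have := hz.1
    rw [Real.norm_of_nonneg (by positivity)]
    rcases k with _ | k
    · simp
    · rw [Nat.add_sub_cancel, pow_succ]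
      have : z ^ k ≤ d ^ k := pow_le_pow_left₀ hz.1.le hz.2.le k
      calc c (k + 1) * (((k + 1 : ℕ) : ℝ) * z ^ k) ≤ c (k + 1) * (((k + 1 : ℕ) : ℝ) * d ^ k) := by
            gcongr
        _ = _ := by field_simp

end PowerSeries

/-! ### Moments of power series distributions -/

section Distribution

variable {a : ℕ → ℝ}

/-- The sum `∑ k ^ j * a k * y ^ k`. -/
noncomputable def psMoment (a : ℕ → ℝ) (j : ℕ) : ℝ → ℝ := psSum fun k => (k : ℝ) ^ j * a k

lemma summable_psMoment (ha : ∀ k, 0 ≤ a k) (j : ℕ) :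
    ∀ y ∈ posInterval (psRadius a), Summable fun k : ℕ => ((k : ℝ) ^ j * a k) * y ^ k := by
  induction j with
  | zero => intro y hy; simpa using summable_of_mem_posInterval_psRadius ha hy
  | succ j ih =>
    intro y hy
    refine (summable_nat_mul (fun k => mul_nonneg (by positivity) (ha k)) ih y hy).congr
      fun k => by ring

lemma hasDerivAt_psMoment (ha : ∀ k, 0 ≤ a k) (j : ℕ) {y : ℝ}
    (hy : y ∈ posInterval (psRadius a)) :
    HasDerivAt (psMoment a j) (psMoment a (j + 1) y / y) y := by
  refine (hasDerivAt_psSum (fun k => mul_nonneg (by positivity) (ha k))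
    (summable_psMoment ha j) hy).congr_deriv ?_
  simp only [psMoment, pow_succ', mul_assoc]

lemma psMoment_zero : psMoment a 0 = psSum a := by simp [psMoment]

lemma psSum_pos (ha : ∀ k, 0 ≤ a k) {i : ℕ} (hi : 0 < a i) {y : ℝ}
    (hy : y ∈ posInterval (psRadius a)) : 0 < psSum a y := by
  have hy0 := hy.1
  exact (summable_of_mem_posInterval_psRadius ha hy).tsum_pos
    (fun k => by have := ha k; positivity) i (by positivity)

lemma isProbabilityMeasure_psd (ha : ∀ k, 0 ≤ a k) {i : ℕ} (hi : 0 < a i) {y : ℝ}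
    (hy : y ∈ posInterval (psRadius a)) : IsProbabilityMeasure (psd a y) := by
  have hP := psSum_pos ha hi hy
  have hy0 := hy.1
  have hs := (summable_of_mem_posInterval_psRadius ha hy).div_const (psSum a y)
  constructor
  rw [psd, Measure.sum_apply _ MeasurableSet.univ]
  simp only [Measure.smul_apply, measure_univ, smul_eq_mul, mul_one]
  rw [← ENNReal.ofReal_tsum_of_nonneg (fun k => by have := ha k; positivity) hs, tsum_div_const]
  change ENNReal.ofReal (psSum a y / psSum a y) = 1
  rw [div_self hP.ne', ENNReal.ofReal_one]

lemma integrable_pow_psd (ha : ∀ k, 0 ≤ a k) {i : ℕ} (hi : 0 < a i) (j : ℕ) {y : ℝ}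
    (hy : y ∈ posInterval (psRadius a)) : Integrable (fun k : ℕ => (k : ℝ) ^ j) (psd a y) := by
  have hP := psSum_pos ha hi hy
  have hy0 := hy.1
  refine integrable_sum_dirac (fun _ => ENNReal.ofReal_ne_top) ?_
  refine ((summable_psMoment ha j y hy).div_const (psSum a y)).congr fun k => ?_
  have := ha k
  rw [ENNReal.toReal_ofReal (by positivity), Real.norm_of_nonneg (by positivity)]
  ring

lemma integral_pow_psd (ha : ∀ k, 0 ≤ a k) {i : ℕ} (hi : 0 < a i) (j : ℕ) {y : ℝ}
    (hy : y ∈ posInterval (psRadius a)) :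
    ∫ k, (k : ℝ) ^ j ∂(psd a y) = psMoment a j y / psSum a y := by
  have hP := psSum_pos ha hi hy
  have hy0 := hy.1
  rw [psd, ← (hasSum_integral_measure (integrable_pow_psd ha hi j hy)).tsum_eq, psMoment,
    psSum.eq_def (fun k => (k : ℝ) ^ j * a k), ← tsum_div_const]
  congr 1
  funext k
  have := ha k
  rw [integral_smul_measure, integral_dirac, ENNReal.toReal_ofReal (by positivity), smul_eq_mul]
  ring

lemma psdMean_eq (ha : ∀ k, 0 ≤ a k) {i : ℕ} (hi : 0 < a i) {y : ℝ}
    (hy : y ∈ posInterval (psRadius a)) : psdMean a y = psMoment a 1 y / psSum a y := by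
  simpa [psdMean] using integral_pow_psd ha hi 1 hy

lemma memLp_psd (ha : ∀ k, 0 ≤ a k) {i : ℕ} (hi : 0 < a i) {y : ℝ}
    (hy : y ∈ posInterval (psRadius a)) : MemLp (fun k : ℕ => (k : ℝ)) 2 (psd a y) :=
  (memLp_two_iff_integrable_sq Measurable.of_discrete.aestronglyMeasurable).2
    (integrable_pow_psd ha hi 2 hy)

lemma psdVariance_eq (ha : ∀ k, 0 ≤ a k) {i : ℕ} (hi : 0 < a i) {y : ℝ}
    (hy : y ∈ posInterval (psRadius a)) :
    psdVariance a y = psMoment a 2 y / psSum a y - (psMoment a 1 y / psSum a y) ^ 2 := by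
  have := isProbabilityMeasure_psd ha hi hy
  rw [psdVariance, variance_eq_sub (memLp_psd ha hi hy), ← integral_pow_psd ha hi 2 hy,
    ← integral_pow_psd ha hi 1 hy]
  simp

/-- The derivative of the mean with respect to `log y` is the variance. -/
lemma hasDerivAt_psdMean (ha : ∀ k, 0 ≤ a k) {i : ℕ} (hi : 0 < a i) {y : ℝ}
    (hy : y ∈ posInterval (psRadius a)) :
    HasDerivAt (psdMean a) (psdVariance a y / y) y := by
  have hP := psSum_pos ha hi hy
  have hy0 := hy.1
  have h0 := hasDerivAt_psMoment ha 0 hy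
  rw [psMoment_zero] at h0
  have h := ((hasDerivAt_psMoment ha 1 hy).div h0 hP.ne').congr_of_eventuallyEq
    (Filter.eventuallyEq_of_mem ((isOpen_posInterval _).mem_nhds hy)
      fun z hz => psdMean_eq ha hi hz)
  refine h.congr_deriv ?_
  rw [psdVariance_eq ha hi hy]
  field_simp

/-- The variance times the sum of the series is `∑ (k - m)² a k y ^ k`, and at most one of `i`, `j`
equals the mean `m`. -/
lemma psdVariance_pos (ha : ∀ k, 0 ≤ a k) {i j : ℕ} (hij : i ≠ j) (hi : 0 < a i) (hj : 0 < a j)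
    {y : ℝ} (hy : y ∈ posInterval (psRadius a)) : 0 < psdVariance a y := by
  have hP := psSum_pos ha hi hy
  have hy0 := hy.1
  set m := psMoment a 1 y / psSum a y with hm
  have h0 := (summable_psMoment ha 0 y hy).hasSum
  have h1 := (summable_psMoment ha 1 y hy).hasSum
  have h2 := (summable_psMoment ha 2 y hy).hasSum
  have hs : HasSum (fun k : ℕ => ((k : ℝ) - m) ^ 2 * (a k * y ^ k))
      (psMoment a 2 y - 2 * m * psMoment a 1 y + m ^ 2 * psMoment a 0 y) := by
    refine ((h2.sub (h1.mul_left (2 * m))).add (h0.mul_left (m ^ 2))).congr_fun ?_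
    intro k
    ring
  have hval : psMoment a 2 y - 2 * m * psMoment a 1 y + m ^ 2 * psMoment a 0 y
      = psdVariance a y * psSum a y := by
    rw [psdVariance_eq ha hi hy, psMoment_zero, hm]
    field_simp
    ring
  rw [hval] at hs
  obtain ⟨k, hk, hkm⟩ : ∃ k, 0 < a k ∧ (k : ℝ) ≠ m := by
    by_cases h : (i : ℝ) = m
    · exact ⟨j, hj, fun h' => hij (by exact_mod_cast h.trans h'.symm)⟩
    · exact ⟨i, hi, h⟩
  have hle := le_hasSum hs k fun l _ => by have := ha l; positivity
  have : 0 < ((k : ℝ) - m) ^ 2 * (a k * y ^ k) := by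
    have := sub_ne_zero.2 hkm
    positivity
  exact pos_of_mul_pos_left (this.trans_le hle) hP.le

lemma strictMonoOn_psdMean (ha : ∀ k, 0 ≤ a k) {i j : ℕ} (hij : i ≠ j) (hi : 0 < a i)
    (hj : 0 < a j) : StrictMonoOn (psdMean a) (posInterval (psRadius a)) := by
  refine strictMonoOn_of_deriv_pos (ordConnected_posInterval _).convex
    (fun y hy => (hasDerivAt_psdMean ha hi hy).continuousAt.continuousWithinAt) fun y hy => ?_
  rw [(isOpen_posInterval _).interior_eq] at hy
  rw [(hasDerivAt_psdMean ha hi hy).deriv]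
  exact div_pos (psdVariance_pos ha hij hi hj hy) hy.1

end Distribution

/-! ### Inverse functions and the differential equations -/

/-- `S` is the supremum of `s`, possibly `∞`; it is not attained because `s` is strictly increasing
and the interval has no largest element. -/
lemma exists_image_eq_posInterval {s : ℝ → ℝ} {R : ℝ≥0∞} (hR : 0 < R)
    (hmono : StrictMonoOn s (posInterval R)) (hcont : ContinuousOn s (posInterval R))
    (hpos : ∀ x ∈ posInterval R, 0 < s x) (hinf : ∀ y, 0 < y → ∃ x ∈ posInterval R, s x < y) :
    ∃ S : ℝ≥0∞, 0 < S ∧ s '' posInterval R = posInterval S := by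
  have hlt : ∀ x ∈ posInterval R,
      ENNReal.ofReal (s x) < ⨆ x ∈ posInterval R, ENNReal.ofReal (s x) := by
    intro x hx
    obtain ⟨x', hx', hxx'⟩ := exists_lt_mem_posInterval hx
    exact ((ENNReal.ofReal_lt_ofReal_iff (hpos x' hx')).2 (hmono hx hx' hxx')).trans_le
      (le_iSup₂ (f := fun x (_ : x ∈ posInterval R) => ENNReal.ofReal (s x)) x' hx')
  refine ⟨⨆ x ∈ posInterval R, ENNReal.ofReal (s x), ?_, Subset.antisymm ?_ ?_⟩
  · obtain ⟨x, hx⟩ := posInterval_nonempty hR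
    exact bot_le.trans_lt (hlt x hx)
  · rintro _ ⟨x, hx, rfl⟩
    exact ⟨hpos x hx, hlt x hx⟩
  · rintro y ⟨hy0, hyS⟩
    simp only [lt_iSup_iff] at hyS
    obtain ⟨x₂, hx₂, h₂⟩ := hyS
    obtain ⟨x₁, hx₁, h₁⟩ := hinf y hy0
    have := ordConnected_posInterval R
    exact this.isPreconnected.intermediate_value hx₁ hx₂ hcont
      ⟨h₁.le, ((ENNReal.ofReal_lt_ofReal_iff (hpos x₂ hx₂)).1 h₂).le⟩

lemma StrictMonoOn.hasDerivAt_invFunOn {s s' : ℝ → ℝ} {I J : Set ℝ} (hmono : StrictMonoOn s I)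
    (himg : s '' I = J) (hI : IsOpen I) (hJ : IsOpen J)
    (hs : ∀ x ∈ I, HasDerivAt s (s' x) x) (hs' : ∀ x ∈ I, s' x ≠ 0) {y : ℝ} (hy : y ∈ J) :
    HasDerivAt (Function.invFunOn s I) (s' (Function.invFunOn s I y))⁻¹ y := by
  have hmem : ∀ y ∈ J, Function.invFunOn s I y ∈ I := fun y hy =>
    Function.invFunOn_mem (himg.symm.subset hy)
  have heq : ∀ y ∈ J, s (Function.invFunOn s I y) = y := fun y hy =>
    Function.invFunOn_eq (himg.symm.subset hy)
  have hg : StrictMonoOn (Function.invFunOn s I) J := fun y hy z hz hyz =>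
    (hmono.lt_iff_lt (hmem y hy) (hmem z hz)).1 (by rwa [heq y hy, heq z hz])
  have hgimg : Function.invFunOn s I '' J = I := by
    rw [← himg]
    exact hmono.injOn.invFunOn_image Subset.rfl
  exact HasDerivAt.of_local_left_inverse
    (hg.continuousAt_of_image_mem_nhds (hJ.mem_nhds hy)
      (by rw [hgimg]; exact hI.mem_nhds (hmem y hy)))
    (hs _ (hmem y hy)) (hs' _ (hmem y hy)) (Filter.eventually_of_mem (hJ.mem_nhds hy) heq)

/-- If `g` solves `y * g' = g * (1 + g * U g)` and `ω` solves `y * ω' = g * ω`, with `U` absolutely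
monotone, then `ω` has non-negative derivatives of every order. -/
lemma exists_nonnegDerivSeq_of_ode {F : ℕ → ℝ → ℝ} {R S : ℝ≥0∞} (hF : NonnegDerivSeq F R)
    {g ω : ℝ → ℝ} (hg : MapsTo g (posInterval S) (posInterval R))
    (hω : ∀ y ∈ posInterval S, 0 ≤ ω y)
    (hg' : ∀ y ∈ posInterval S, HasDerivAt g (g y * (1 + g y * F 0 (g y)) / y) y)
    (hω' : ∀ y ∈ posInterval S, HasDerivAt ω (g y / y * ω y) y) :
    ∃ G, NonnegDerivSeq G S ∧ G 0 = ω := by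
  set u : ℝ → ℝ := fun y => g y / y with hu
  set T : Set (ℝ → ℝ) := {u, g, ω} ∪ range fun k => F k ∘ g with hT
  have mem : ∀ f ∈ T, f ∈ Subsemiring.closure T := fun f hf => Subsemiring.subset_closure hf
  have hum : u ∈ Subsemiring.closure T := mem _ (by simp [hT])
  have hgm : g ∈ Subsemiring.closure T := mem _ (by simp [hT])
  have hωm : ω ∈ Subsemiring.closure T := mem _ (by simp [hT])
  have hFm : ∀ k, F k ∘ g ∈ Subsemiring.closure T := fun k => mem _ (Or.inr ⟨k, rfl⟩)
  have hDg : u + g * u * (F 0 ∘ g) ∈ Subsemiring.closure T :=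
    add_mem hum (mul_mem (mul_mem hgm hum) (hFm 0))
  have hg2 : ∀ y ∈ posInterval S, HasDerivAt g ((u + g * u * (F 0 ∘ g)) y) y := by
    intro y hy
    refine (hg' y hy).congr_deriv ?_
    simp only [Pi.add_apply, Pi.mul_apply, Function.comp_apply, hu]
    ring
  refine exists_nonnegDerivSeq_of_mem_closure (T := T) ?_ ?_ hωm
  · rintro f ((rfl | rfl | rfl) | ⟨k, rfl⟩) y hy
    · exact div_nonneg (hg hy).1.le hy.1.le
    · exact (hg hy).1.le
    · exact hω y hy
    · exact hF.nonneg k _ (hg hy)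
  · rintro f ((rfl | rfl | rfl) | ⟨k, rfl⟩)
    -- In `u' = (y g' - g) / y²` the summand `g` of `y g'` cancels `-g`.
    · refine ⟨u * u * (F 0 ∘ g), mul_mem (mul_mem hum hum) (hFm 0), fun y hy => ?_⟩
      refine ((hg' y hy).div (hasDerivAt_id y) hy.1.ne').congr_deriv ?_
      have := hy.1.ne'
      simp only [Pi.mul_apply, Function.comp_apply, hu, id]
      field_simp
      ring
    · exact ⟨_, hDg, hg2⟩
    · exact ⟨u * f, mul_mem hum hωm, hω'⟩
    · exact ⟨(F (k + 1) ∘ g) * (u + g * u * (F 0 ∘ g)), mul_mem (hFm _) hDg,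
        fun y hy => (hF.hasDerivAt k _ (hg hy)).comp y (hg2 y hy)⟩

/-- If `∑ a k * y ^ k = ω y` and `g` is the logarithmic derivative of `ω` with respect to `log y`,
then `g y` is the mean of the power series distribution. -/
lemma eqOn_psdMean {a : ℕ → ℝ} {g ω : ℝ → ℝ} {S : ℝ≥0∞} (ha : IsPSDFunction a ω S)
    (hω' : ∀ y ∈ posInterval S, HasDerivAt ω (g y / y * ω y) y) :
    ∀ y ∈ posInterval S, psMoment a 1 y = g y * psSum a y ∧ psdMean a y = g y := by
  intro y hy
  have hsub : posInterval S ⊆ posInterval (psRadius a) := fun z hz =>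
    ⟨hz.1, hz.2.trans_le ha.le_radius⟩
  have heq : ∀ z ∈ posInterval S, psSum a z = ω z := fun z hz => (ha.hasSum z hz).tsum_eq
  have h0 := hasDerivAt_psMoment ha.nonneg 0 (hsub hy)
  rw [psMoment_zero] at h0
  have h1 := h0.unique ((hω' y hy).congr_of_eventuallyEq
    (Filter.eventuallyEq_of_mem ((isOpen_posInterval S).mem_nhds hy) heq))
  have hy0 := hy.1.ne'
  have hω : psSum a y ≠ 0 := by rw [heq y hy]; exact (ha.pos y hy).ne'
  have h2 : psMoment a 1 y = g y * psSum a y := by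
    rw [heq y hy]
    field_simp at h1
    simpa using h1
  obtain ⟨i, hi⟩ : ∃ i, 0 < a i := by
    by_contra! h
    refine hω ?_
    have : ∀ k, a k = 0 := fun k => le_antisymm (h k) (ha.nonneg k)
    simp [psSum, this]
  exact ⟨h2, by rw [psdMean_eq ha.nonneg hi (hsub hy), h2, mul_div_cancel_right₀ _ hω]⟩

/-- A single positive coefficient `a i` would make the mean `g` constantly `i`. Two of them give
positive variance, hence an injective mean. -/
lemma exists_ne_coeff_pos {a : ℕ → ℝ} {g ω : ℝ → ℝ} {S : ℝ≥0∞} (hS : 0 < S)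
    (ha : IsPSDFunction a ω S) (hg : InjOn g (posInterval S))
    (hω' : ∀ y ∈ posInterval S, HasDerivAt ω (g y / y * ω y) y) :
    ∃ i j, i ≠ j ∧ 0 < a i ∧ 0 < a j := by
  by_contra! h
  have heq : ∀ z ∈ posInterval S, psSum a z = ω z := fun z hz => (ha.hasSum z hz).tsum_eq
  obtain ⟨y, hy⟩ := posInterval_nonempty hS
  obtain ⟨z, hz, hyz⟩ := exists_lt_mem_posInterval hy
  obtain ⟨i, hi⟩ : ∃ i, 0 < a i := by
    by_contra! h
    have h0 : ∀ k, a k = 0 := fun k => le_antisymm (h k) (ha.nonneg k)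
    have := ha.pos y hy
    rw [← heq y hy] at this
    simp [psSum, h0] at this
  have h0 : ∀ k, k ≠ i → a k = 0 := fun k hk => le_antisymm (h i k hk.symm hi) (ha.nonneg k)
  have hgi : ∀ y ∈ posInterval S, g y = i := by
    intro y hy
    have hω := (ha.pos y hy).ne'
    rw [← heq y hy] at hω
    refine mul_right_cancel₀ hω ?_
    rw [← (eqOn_psdMean ha hω' y hy).1, psMoment, psSum, psSum, ← tsum_mul_left]
    congr 1
    funext k
    rcases eq_or_ne k i with rfl | hk
    · ring
    · simp [h0 k hk]
  exact hyz.ne (hg hy hz ((hgi y hy).trans (hgi z hz).symm))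

/-! ### The main theorem -/

theorem theorem3 (R : ℝ≥0∞) (hR : 0 < R) (U V : ℝ → ℝ)
    (hU : AbsolutelyMonotoneOn U (posInterval R))
    (hV : ∀ x ∈ posInterval R, V x = x * (1 + x * U x))
    (A B s b : ℝ → ℝ)
    (hA : ∀ x ∈ posInterval R, HasDerivAt A (1 / V x) x)
    (hB : ∀ x ∈ posInterval R, HasDerivAt B (x / V x) x)
    (hs : ∀ x ∈ posInterval R, s x = Real.exp (A x))
    (hb : ∀ x ∈ posInterval R, b x = Real.exp (B x)) :
    ∃ S : ℝ≥0∞, 0 < S ∧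
      StrictMonoOn s (posInterval R) ∧
      s '' posInterval R = posInterval S ∧
      ∃ a : ℕ → ℝ,
        IsPSDFunction a (fun y => b (Function.invFunOn s (posInterval R) y)) S ∧
        IsPSDCovarianceOn a V (posInterval R) := by
  obtain ⟨F, hF, hFU⟩ := hU.exists_nonnegDerivSeq
  have hV' : ∀ x ∈ posInterval R, V x = x * (1 + x * F 0 x) := fun x hx => by
    rw [hV x hx, hFU x hx]
  have hVpos : ∀ x ∈ posInterval R, 0 < V x := fun x hx => by
    have := hF.nonneg 0 x hx
    have := hx.1
    rw [hV' x hx]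
    positivity
  have hspos : ∀ x ∈ posInterval R, 0 < s x := fun x hx => by rw [hs x hx]; positivity
  have hs' : ∀ x ∈ posInterval R, HasDerivAt s (s x / V x) x := fun x hx => by
    refine ((hA x hx).exp.congr_of_eventuallyEq (Filter.eventuallyEq_of_mem
      ((isOpen_posInterval R).mem_nhds hx) hs)).congr_deriv ?_
    rw [hs x hx]
    ring
  have hb' : ∀ x ∈ posInterval R, HasDerivAt b (b x * (x / V x)) x := fun x hx => by
    rw [hb x hx]
    exact (hB x hx).exp.congr_of_eventuallyEq (Filter.eventuallyEq_of_mem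
      ((isOpen_posInterval R).mem_nhds hx) hb)
  have hs0 : ∀ x ∈ posInterval R, 0 < s x / V x := fun x hx => div_pos (hspos x hx) (hVpos x hx)
  have hscont : ContinuousOn s (posInterval R) := fun x hx =>
    (hs' x hx).continuousAt.continuousWithinAt
  have hmono : StrictMonoOn s (posInterval R) := by
    refine strictMonoOn_of_deriv_pos (ordConnected_posInterval R).convex hscont fun x hx => ?_
    rw [(isOpen_posInterval R).interior_eq] at hx
    rw [(hs' x hx).deriv]
    exact hs0 x hx
  have hinf : ∀ y, 0 < y → ∃ x ∈ posInterval R, s x < y := by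
    intro y hy
    obtain ⟨z, hz⟩ := posInterval_nonempty hR
    have hsub : Ioc 0 z ⊆ posInterval R := fun x hx => posInterval_mem_of_le hz hx.1 hx.2
    -- To get `s → 0` at `0`: on `(0, z]`, `1 / V x ≥ 1 / x - F 0 z`, so this function is monotone,
    -- whence `A x ≤ log x + C` and `s x ≤ x exp C`.
    have hd : ∀ x ∈ Ioc 0 z, HasDerivAt (fun x => A x - Real.log x + x * F 0 z)
        (1 / V x - x⁻¹ + 1 * F 0 z) x := fun x hx =>
      ((hA x (hsub hx)).sub (Real.hasDerivAt_log hx.1.ne')).add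
        ((hasDerivAt_id x).mul_const (F 0 z))
    have hm : MonotoneOn (fun x => A x - Real.log x + x * F 0 z) (Ioc 0 z) := by
      refine monotoneOn_of_deriv_nonneg (convex_Ioc 0 z)
        (fun x hx => (hd x hx).continuousAt.continuousWithinAt) ?_ ?_
      · exact fun x hx => (hd x (interior_subset hx)).differentiableAt.differentiableWithinAt
      · intro x hx
        have hx := interior_subset hx
        rw [(hd x hx).deriv, hV' x (hsub hx)]
        have h1 := hF.nonneg 0 x (hsub hx)
        have h2 := hF.monotoneOn 0 (hsub hx) hz hx.2
        have h3 := hx.1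
        have h4 : 1 / (x * (1 + x * F 0 x)) - x⁻¹ = - (F 0 x / (1 + x * F 0 x)) := by
          field_simp
          ring
        have h5 : F 0 x / (1 + x * F 0 x) ≤ F 0 x := div_le_self h1 (by nlinarith)
        rw [h4]
        linarith
    set C := A z - Real.log z + z * F 0 z with hC
    have hle : ∀ x ∈ Ioc 0 z, s x ≤ x * Real.exp C := by
      intro x hx
      have h1 : A x - Real.log x + x * F 0 z ≤ C := hm hx ⟨hz.1, le_rfl⟩ hx.2
      have h2 : 0 ≤ x * F 0 z := mul_nonneg hx.1.le (hF.nonneg 0 z hz)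
      rw [hs x (hsub hx)]
      calc Real.exp (A x) ≤ Real.exp (Real.log x + C) := Real.exp_le_exp.2 (by linarith)
        _ = x * Real.exp C := by rw [Real.exp_add, Real.exp_log hx.1]
    have hw : 0 < y / 2 / Real.exp C := by positivity
    have hx : min z (y / 2 / Real.exp C) ∈ Ioc 0 z := ⟨lt_min hz.1 hw, min_le_left _ _⟩
    refine ⟨_, hsub hx, (hle _ hx).trans_lt ?_⟩
    calc min z (y / 2 / Real.exp C) * Real.exp C ≤ y / 2 / Real.exp C * Real.exp C := by
          gcongr
          exact min_le_right _ _
      _ = y / 2 := by field_simp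
      _ < y := by linarith
  obtain ⟨S, hS, himg⟩ := exists_image_eq_posInterval hR hmono hscont hspos hinf
  refine ⟨S, hS, hmono, himg, ?_⟩
  set g := Function.invFunOn s (posInterval R) with hg
  have hgm : ∀ y ∈ posInterval S, g y ∈ posInterval R := fun y hy =>
    Function.invFunOn_mem (himg.symm.subset hy)
  have hsg : ∀ y ∈ posInterval S, s (g y) = y := fun y hy => Function.invFunOn_eq (himg.symm.subset hy)
  have hgs : ∀ x ∈ posInterval R, g (s x) = x := fun x hx =>
    hmono.injOn.leftInvOn_invFunOn hx
  have hsm : ∀ x ∈ posInterval R, s x ∈ posInterval S := fun x hx => himg ▸ mem_image_of_mem s hx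
  have hg' : ∀ y ∈ posInterval S, HasDerivAt g (V (g y) / y) y := fun y hy => by
    refine (hmono.hasDerivAt_invFunOn himg (isOpen_posInterval R) (isOpen_posInterval S) hs'
      (fun x hx => (hs0 x hx).ne') hy).congr_deriv ?_
    rw [← hg, hsg y hy, inv_div]
  have hω' : ∀ y ∈ posInterval S, HasDerivAt (fun y => b (g y)) (g y / y * b (g y)) y := by
    intro y hy
    refine ((hb' _ (hgm y hy)).comp y (hg' y hy)).congr_deriv ?_
    have := (hVpos _ (hgm y hy)).ne'
    have := hy.1.ne'
    field_simp
  have hωpos : ∀ y ∈ posInterval S, 0 < b (g y) := fun y hy => by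
    rw [hb _ (hgm y hy)]
    positivity
  obtain ⟨G, hG, hG0⟩ := exists_nonnegDerivSeq_of_ode hF hgm (fun y hy => (hωpos y hy).le)
    (fun y hy => hV' _ (hgm y hy) ▸ hg' y hy) hω'
  obtain ⟨a, ha0, hasum⟩ := hG.exists_hasSum_pow hS
  rw [hG0] at hasum
  have ha : IsPSDFunction a (fun y => b (g y)) S :=
    ⟨ha0, le_psRadius ha0 fun y hy => (hasum y hy).summable, hasum, hωpos⟩
  have hsub : posInterval S ⊆ posInterval (psRadius a) := fun z hz =>
    ⟨hz.1, hz.2.trans_le ha.le_radius⟩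
  have hmean : ∀ y ∈ posInterval S, psdMean a y = g y := fun y hy => (eqOn_psdMean ha hω' y hy).2
  obtain ⟨i, j, hij, hi, hj⟩ := exists_ne_coeff_pos hS ha
    (fun y hy z hz h => by rw [← hsg y hy, ← hsg z hz, h]) hω'
  have hinj := (strictMonoOn_psdMean ha0 hij hi hj).injOn
  refine ⟨a, ha, fun y hy => isProbabilityMeasure_psd ha0 hi hy, fun y hy => memLp_psd ha0 hi hy,
    hinj, fun x hx => ⟨s x, hsub (hsm x hx), ?_⟩, fun x hx => ?_⟩
  · rw [hmean _ (hsm x hx), hgs x hx]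
  · have hy := hsm x hx
    -- `psdParam` inverts the mean on all of `(0, ρ)`, so injectivity is needed there and not only
    -- on `(0, S)`.
    have hpar : psdParam a x = s x := by
      have := hinj.leftInvOn_invFunOn (hsub hy)
      rwa [hmean _ hy, hgs x hx] at this
    -- Two derivatives of the mean at `y = s x`: variance over `y` from the series, `V (g y) / y`
    -- from the equation for `g`.
    have h := (hasDerivAt_psdMean ha0 hi (hsub hy)).unique ((hg' _ hy).congr_of_eventuallyEq
      (Filter.eventuallyEq_of_mem ((isOpen_posInterval S).mem_nhds hy) hmean))
    rw [psdCovariance, hpar, (div_left_inj' hy.1.ne').1 h, hgs x hx]
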